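/- Let $G$ be a finite simple graph with vertex set $V$ and edge set $E(G)$, let $k$ be a field, let $K$ be an infinite field extension of $k$ (for instance $K=k$ if $k$ is infinite, or $K=\overline{k}$), and let $s\ge 0$ be an integer. Let $R=k[x : x\in V]$, let $I(G)=\langle xy : \{x,y\}\in E(G)\rangle\subseteq R$ be the edge ideal, and let $X=\mathcal V(I(G))\subseteq K^V$. For a set $S$ of $K$-points of an affine space, $\mathcal I(S)$ denotes the ideal of polynomials over $k$ vanishing on $S$, and the Zariski closure of $S$ is $\mathcal V(\mathcal I(S))$. The ring of $s$-jets is $\mathcal J_s(R)=k[x^{(i)} : x\in V,\ 0\le i\le s]$. For an ideal $I\subseteq R$, $\mathcal J_s(I)\subseteq \mathcal J_s(R)$ is the ideal generated by the coefficients of $1,t,\dots,t^s$ in the polynomials obtained from the elements $f\in I$ by substituting $x\mapsto x^{(0)}+x^{(1)}t+\dots+x^{(s)}t^s$; the variety of $s$-jets of $X$ is $\mathcal J_s(X)=\mathcal V(\mathcal J_s(\mathcal I(X)))$, and $\pi_s:\mathcal J_s(X)\to X$ is the projection onto the coordinates $x^{(0)}$. The smooth locus $X_{\mathrm{smooth}}$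 is the set of $p\in X$ at which the tangent space $T_pX=\{w\in K^V : \sum_{x}\frac{\partial f}{\partial x}(p)\,w_x=0 \text{ for all } f\in\mathcal I(X)\}$ has dimension equal to the largest dimension of an irreducible component of $X$ through $p$. Its $s$-jets are $\mathcal J_s(X_{\mathrm{smooth}})=\pi_s^{-1}(X_{\mathrm{smooth}})$, and the $s$-order principal component of $G$ is the Zariski closure $\overline{\mathcal J_s(X_{\mathrm{smooth}})}$. Then the ideal of the $s$-order principal component of $G$ is $$\mathcal I\big(\overline{\mathcal J_s(X_{\mathrm{smooth}})}\big)=\langle x^{(i)}y^{(j)} : \{x,y\}\in E(G),\ 0\le i,j\le s\rangle .$$ Equivalently, if $W_1,\dots,W_m$ are the minimal vertex covers of $G$ and $\mathcal J_s(W_\alpha)=\{x^{(i)} : x\in W_\alpha,\ 0\le i\le s\}$, then every ideal $\langle \mathcal J_s(W_\alpha)\rangle$ is prime and $$\mathcal I\big(\overline{\mathcal J_s(X_{\mathrm{smooth}})}\big)=\bigcap_{\alpha=1}^m\langle \mathcal J_s(W_\alpha)\rangle .$$ -/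

import Mathlib

open MvPolynomial

noncomputable section

namespace JetGraph

/-- The ring of `s`-jets of `k[x_v : v ∈ V]`: the polynomial ring in the variables `x_v^(i)`,
`v ∈ V`, `0 ≤ i ≤ s`. The variable `x_v^(i)` is `X (v, i)`. -/
abbrev JetRing (k V : Type*) [Field k] (s : ℕ) : Type _ :=
  MvPolynomial (V × Fin (s + 1)) k

/-- The homomorphism `x_v ↦ x_v^(0) + x_v^(1) t + ⋯ + x_v^(s) t^s`. Its values are polynomials
in `t`; only their coefficients in degrees `≤ s`, i.e. their classes modulo `t^(s+1)`,
are used below. -/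
def jetHom (k V : Type*) [Field k] (s : ℕ) :
    MvPolynomial V k →ₐ[k] Polynomial (JetRing k V s) :=
  aeval fun v => ∑ i : Fin (s + 1), Polynomial.C (X (v, i)) * Polynomial.X ^ (i : ℕ)

/-- The ideal of `s`-jets `J_s(I)` of an ideal `I`: generated by the coefficients of
`1, t, …, t^s` in the images under `jetHom` of the elements of `I` (those coming from a set of
generators of `I` generate the same ideal). -/
def jetIdeal {k V : Type*} [Field k] (s : ℕ) (I : Ideal (MvPolynomial V k)) :
    Ideal (JetRing k V s) :=
  Ideal.span {g | ∃ f ∈ I, ∃ l ≤ s, g = (jetHom k V s f).coeff l}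

section Varieties

variable (k : Type*) {K V : Type*} [Field k] [Field K] [Algebra k K]

/-- Zariski closure of a set of `K`-points of affine space: the common zeros of all
polynomials over `k` vanishing on the set. -/
def zariskiClosure (S : Set (V → K)) : Set (V → K) :=
  zeroLocus K (vanishingIdeal k S)

/-- The tangent space of `Z` at `p` (translated to the origin): the common kernel of the
differentials at `p` of the polynomials vanishing on `Z`. -/
def tangentSpace [Fintype V] (Z : Set (V → K)) (p : V → K) : Submodule K (V → K) where
  carrier := {w | ∀ f ∈ vanishingIdeal k Z, ∑ v, aeval p (pderiv v f) * w v = 0}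
  zero_mem' := by intro f _; simp
  add_mem' := by
    intro a b ha hb f hf
    simp only [Pi.add_apply, mul_add, Finset.sum_add_distrib, ha f hf, hb f hf, add_zero]
  smul_mem' := by
    intro c a ha f hf
    have h : ∑ v, aeval p (pderiv v f) * (c • a) v
        = c * ∑ v, aeval p (pderiv v f) * a v := by
      rw [Finset.mul_sum]
      exact Finset.sum_congr rfl fun v _ => by simp only [Pi.smul_apply, smul_eq_mul]; ring
    rw [h, ha f hf, mul_zero]

/-- The dimension of `Z` at `p`: the largest dimension of an irreducible component of `Z`
through `p`. The ideals of the irreducible components of `Z` are the minimal primes over the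
ideal of `Z`, and the dimension of a component is the Krull dimension of its coordinate ring. -/
def localDim (Z : Set (V → K)) (p : V → K) : WithBot ℕ∞ :=
  ⨆ q ∈ {q ∈ (vanishingIdeal k Z).minimalPrimes | p ∈ zeroLocus K q},
    ringKrullDim (MvPolynomial V k ⧸ q)

/-- The smooth locus of `Z`: the points whose tangent space has dimension `dim_p Z`. -/
def smoothLocus [Fintype V] (Z : Set (V → K)) : Set (V → K) :=
  {p ∈ Z | (Module.finrank K (tangentSpace k Z p) : WithBot ℕ∞) = localDim k Z p}

/-- The variety of `s`-jets `J_s(Z)` of a variety `Z`. -/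
def jetVariety (s : ℕ) (Z : Set (V → K)) : Set (V × Fin (s + 1) → K) :=
  zeroLocus K (jetIdeal s (vanishingIdeal k Z))

/-- The canonical projection `π_s` sending a jet to its base point. -/
def jetBase (s : ℕ) (γ : V × Fin (s + 1) → K) : V → K := fun v => γ (v, 0)

/-- The `s`-jets of an open subset `U` of `Z`: the jets of `Z` that factor through `U`.
As `Spec K[t]/(t^(s+1))` has only one point, these are the jets of `Z` with base point in `U`. -/
def jetsOfOpen (s : ℕ) (Z U : Set (V → K)) : Set (V × Fin (s + 1) → K) :=
  {γ ∈ jetVariety k s Z | jetBase s γ ∈ U}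

end Varieties

section Graphs

variable (k : Type*) {V : Type*} [Field k]

/-- The edge ideal of a graph. -/
def edgeIdeal (G : SimpleGraph V) : Ideal (MvPolynomial V k) :=
  Ideal.span {f | ∃ x y, G.Adj x y ∧ f = X x * X y}

/-- The `s`-order principal component of a graph: the Zariski closure of the `s`-jets of the
smooth locus of the variety of the edge ideal. -/
def principalComponent (K : Type*) [Field K] [Algebra k K] [Fintype V] (s : ℕ)
    (G : SimpleGraph V) : Set (V × Fin (s + 1) → K) :=
  let Z : Set (V → K) := zeroLocus K (edgeIdeal k G)
  zariskiClosure k (jetsOfOpen k s Z (smoothLocus k Z))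

/-- The ideal `⟨J_s(W)⟩` generated by all `x^(i)` with `x ∈ W`, `0 ≤ i ≤ s`. -/
def jetCoverIdeal (s : ℕ) (W : Set V) : Ideal (JetRing k V s) :=
  Ideal.span {f | ∃ x ∈ W, ∃ i : Fin (s + 1), f = X (x, i)}

/-- The ideal generated by all `x^(i) y^(j)` with `{x, y}` an edge and `0 ≤ i, j ≤ s`. -/
def jetEdgeIdeal (s : ℕ) (G : SimpleGraph V) : Ideal (JetRing k V s) :=
  Ideal.span {f | ∃ x y, G.Adj x y ∧ ∃ i j : Fin (s + 1), f = X (x, i) * X (y, j)}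

end Graphs

end JetGraph

end

/-! The variety `X` is a union of coordinate subspaces, one per minimal vertex cover. Let `p ∈ X`
have support `S`, and let `N` be the set of neighbours of `S`. The tangent space at `p` is cut out
by `w y = 0` for `y ∈ N`, while every cover `W` whose subspace passes through `p` contains `N`. So
`p` is smooth iff `N` is itself a cover, necessarily minimal
(`mem_smoothLocus_zeroLocus_edgeIdeal`). Along a jet over `p`, the arc of a vertex of `S` is a unit
modulo `t^(s+1)`, so the arcs of its neighbours vanish (`apply_eq_zero_of_mem_jetVariety`): jets
over smooth points lie in the coordinate subspaces of the `J_s(W)`. Conversely, the points of such a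
subspace whose free coordinates are all nonzero are jets over smooth points, and they are dense
because `K` is infinite. The closure thus has ideal `⋂ ⟨J_s(W)⟩`, which a monomial argument
(`iInf_span_X_image_preimage`) turns into the ideal of edge products. -/

open MvPolynomial

/-! ### Ideals generated by variables -/

namespace MvPolynomial

variable {k σ : Type*} [Field k]

/-- The ideal generated by a set of variables is the kernel of the map killing them. -/
theorem ker_killCompl_compl (A : Set σ) :
    RingHom.ker (killCompl (R := k) (Subtype.val_injective (p := fun a => a ∈ Aᶜ)))
      = Ideal.span (X '' A) := by
  set κ := killCompl (R := k) (Subtype.val_injective (p := fun a => a ∈ Aᶜ)) with hκ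
  have hout : ∀ (a : σ) (ha : a ∉ A), κ (X a) = X (⟨a, ha⟩ : {a // a ∈ Aᶜ}) := by
    intro a ha
    have h := killCompl_rename_app (R := k) (Subtype.val_injective (p := fun a => a ∈ Aᶜ))
      (X (⟨a, ha⟩ : {a // a ∈ Aᶜ}))
    rwa [rename_X] at h
  have hin : ∀ a ∈ A, κ (X a) = 0 := by
    intro a ha
    rw [hκ, killCompl, aeval_X, dif_neg]
    simpa using ha
  apply le_antisymm
  -- Killing the variables in `A` and then including back changes a polynomial only modulo the
  -- ideal.
  · have hcomp : ((Ideal.Quotient.mkₐ k (Ideal.span (X '' A : Set (MvPolynomial σ k)))).comp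
        (rename Subtype.val)).comp κ = Ideal.Quotient.mkₐ k (Ideal.span (X '' A)) := by
      ext a
      simp only [AlgHom.comp_apply]
      by_cases ha : a ∈ A
      · rw [hin a ha, map_zero, map_zero]
        symm
        exact Ideal.Quotient.eq_zero_iff_mem.2 (Ideal.subset_span (Set.mem_image_of_mem X ha))
      · rw [hout a ha, rename_X]
    intro f hf
    rw [RingHom.mem_ker] at hf
    rw [← Ideal.Quotient.eq_zero_iff_mem]
    have h := DFunLike.congr_fun hcomp f
    simp only [AlgHom.comp_apply] at h
    rw [hf, map_zero, map_zero] at h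
    exact h.symm
  · rw [Ideal.span_le]
    rintro _ ⟨a, ha, rfl⟩
    exact hin a ha

theorem isPrime_span_X_image (A : Set σ) :
    (Ideal.span (X '' A : Set (MvPolynomial σ k))).IsPrime := by
  rw [← ker_killCompl_compl]
  exact RingHom.ker_isPrime _

theorem span_X_image_le_iff {A B : Set σ} :
    Ideal.span (X '' A : Set (MvPolynomial σ k)) ≤ Ideal.span (X '' B) ↔ A ⊆ B := by
  refine ⟨fun h a ha => ?_, fun h => Ideal.span_mono (Set.image_mono h)⟩
  have hmem := h (Ideal.subset_span ⟨a, ha, rfl⟩)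
  rw [mem_ideal_span_X_image] at hmem
  obtain ⟨b, hb, hab⟩ := hmem (Finsupp.single a 1) (by simp [support_X])
  have : a = b := by
    by_contra hne
    exact hab (Finsupp.single_eq_of_ne (Ne.symm hne))
  exact this ▸ hb

theorem ringKrullDim_quotient_span_X_image [Finite σ] (A : Set σ) :
    ringKrullDim (MvPolynomial σ k ⧸ Ideal.span (X '' A : Set (MvPolynomial σ k)))
      = (Aᶜ.ncard : WithBot ℕ∞) := by
  have hsurj : Function.Surjective
      (killCompl (R := k) (Subtype.val_injective (p := fun a => a ∈ Aᶜ))) :=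
    fun f => ⟨_, killCompl_rename_app _ f⟩
  rw [← ker_killCompl_compl,
    ringKrullDim_eq_of_ringEquiv (Ideal.quotientKerAlgEquivOfSurjective hsurj).toRingEquiv,
    MvPolynomial.ringKrullDim_of_isNoetherianRing]
  rw [ringKrullDim_eq_zero_of_field, zero_add]
  rfl

variable {K : Type*} [Field K] [Algebra k K] [Infinite K]

/-- A polynomial vanishing on the torus of a coordinate subspace lies in the ideal of that
subspace. -/
theorem mem_span_X_image_of_aeval_eq_zero {A : Set σ} {f : MvPolynomial σ k}
    (hf : ∀ p : σ → K, (∀ a ∈ A, p a = 0) → (∀ a ∉ A, p a ≠ 0) → aeval p f = 0) :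
    f ∈ Ideal.span (X '' A) := by
  classical
  rw [← ker_killCompl_compl, RingHom.mem_ker]
  set g := killCompl (R := k) (Subtype.val_injective (p := fun a => a ∈ Aᶜ)) f with hg
  apply map_injective (algebraMap k K) (algebraMap k K).injective
  rw [map_zero]
  refine funext_set (fun _ => {0}ᶜ) (fun _ => (Set.finite_singleton 0).infinite_compl) ?_
  intro p hp
  rw [map_zero, eval_map, ← aeval_def]
  have hcomp : (aeval p).comp (killCompl (R := k) (Subtype.val_injective (p := fun a => a ∈ Aᶜ)))
      = aeval (fun a => if ha : a ∈ Aᶜ then p ⟨a, ha⟩ else 0) := by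
    ext a
    by_cases ha : a ∈ Aᶜ
    · have h := killCompl_rename_app (R := k) (Subtype.val_injective (p := fun a => a ∈ Aᶜ))
        (X ⟨a, ha⟩)
      rw [rename_X] at h
      rw [AlgHom.comp_apply, h, aeval_X, aeval_X, dif_pos ha]
    · rw [AlgHom.comp_apply, killCompl, aeval_X, dif_neg (by simpa using ha), map_zero, aeval_X,
        dif_neg ha]
  rw [hg, ← AlgHom.comp_apply, hcomp]
  refine hf _ (fun a ha => dif_neg (by simpa using ha)) (fun a ha => ?_)
  rw [dif_pos (show a ∈ Aᶜ from ha)]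
  exact hp _ trivial

theorem vanishingIdeal_zeroLocus_vanishingIdeal {k K σ : Type*} [Field k] [Field K] [Algebra k K]
    (S : Set (σ → K)) :
    vanishingIdeal k (zeroLocus K (vanishingIdeal k S)) = vanishingIdeal k S :=
  zeroLocus_vanishingIdeal_galoisConnection.u_l_u_eq_u S

end MvPolynomial

/-! ### Minimal vertex covers -/

namespace SimpleGraph

variable {V : Type*} {G : SimpleGraph V}

/-- Every vertex of a minimal vertex cover has a neighbour outside the cover. -/
theorem exists_adj_notMem_of_minimal_isVertexCover {W : Set V} (hW : Minimal G.IsVertexCover W)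
    {x : V} (hx : x ∈ W) : ∃ y ∉ W, G.Adj y x := by
  by_contra! h
  have hcov : G.IsVertexCover (W \ {x}) := by
    intro u v huv
    have := hW.prop huv
    have hne := huv.ne
    have h1 : ∀ y, G.Adj y x → y ∈ W := fun y hy => by
      by_contra hyW
      exact h y hyW hy
    by_cases hu : u = x
    · subst hu
      exact Or.inr ⟨h1 v huv.symm, fun hv => hne hv.symm⟩
    · by_cases hv : v = x
      · subst hv
        exact Or.inl ⟨h1 u huv, hu⟩
      · exact this.imp (fun h => ⟨h, hu⟩) (fun h => ⟨h, hv⟩)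
  exact (hW.le_of_le hcov Set.sdiff_subset hx).2 rfl

theorem exists_minimal_isVertexCover_subset [Finite V] {C : Set V} (hC : G.IsVertexCover C) :
    ∃ W ⊆ C, Minimal G.IsVertexCover W :=
  exists_minimal_le_of_wellFoundedLT G.IsVertexCover C hC

/-- The set of vertices adjacent to some vertex of `S`. -/
def neighborsOf (G : SimpleGraph V) (S : Set V) : Set V := {y | ∃ x ∈ S, G.Adj x y}

theorem neighborsOf_subset {W S : Set V} (hW : G.IsVertexCover W) (hWS : Disjoint W S) :
    G.neighborsOf S ⊆ W := by
  rintro y ⟨x, hx, hxy⟩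
  exact (hW hxy).resolve_left fun h => Set.disjoint_left.1 hWS h hx

theorem neighborsOf_compl_of_minimal {W : Set V} (hW : Minimal G.IsVertexCover W) :
    G.neighborsOf Wᶜ = W := by
  refine (neighborsOf_subset hW.prop disjoint_compl_right).antisymm fun x hx => ?_
  obtain ⟨y, hy, hyx⟩ := exists_adj_notMem_of_minimal_isVertexCover hW hx
  exact ⟨y, hy, hyx⟩

/-- If the neighbours of an independent set `S` form a vertex cover, it is a minimal one. -/
theorem minimal_neighborsOf {S : Set V} (hS : ∀ x ∈ S, ∀ y ∈ S, ¬ G.Adj x y)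
    (hcov : G.IsVertexCover (G.neighborsOf S)) : Minimal G.IsVertexCover (G.neighborsOf S) := by
  -- A cover inside the neighbours of `S` misses `S` by independence, hence contains all those
  -- neighbours.
  refine ⟨hcov, fun W hW hWN => neighborsOf_subset hW ?_⟩
  refine Set.disjoint_left.2 fun x hxW hxS => ?_
  obtain ⟨z, hz, hzx⟩ := hWN hxW
  exact hS z hz x hxS hzx

end SimpleGraph

/-! ### Decomposition of edge ideals -/

namespace JetGraph

variable {k V : Type*} [Field k]

/-- The ideal generated by the products `x_a x_b` with `{φ a, φ b}` an edge is the intersection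
of the ideals generated by the preimages of the minimal vertex covers. -/
theorem iInf_span_X_image_preimage [Finite V] {σ : Type*} (G : SimpleGraph V) (φ : σ → V) :
    ⨅ W ∈ {W : Set V | Minimal G.IsVertexCover W}, Ideal.span (X '' (φ ⁻¹' W))
      = Ideal.span {f : MvPolynomial σ k | ∃ a b, G.Adj (φ a) (φ b) ∧ f = X a * X b} := by
  classical
  apply le_antisymm
  · intro f hf
    have hgen : {f : MvPolynomial σ k | ∃ a b, G.Adj (φ a) (φ b) ∧ f = X a * X b}
        = (fun m => monomial m (1 : k)) ''
          {m | ∃ a b, G.Adj (φ a) (φ b) ∧ m = Finsupp.single a 1 + Finsupp.single b 1} := by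
      ext g
      constructor
      · rintro ⟨a, b, hab, rfl⟩
        exact ⟨_, ⟨a, b, hab, rfl⟩, by simp [X, monomial_mul]⟩
      · rintro ⟨_, ⟨a, b, hab, rfl⟩, rfl⟩
        exact ⟨a, b, hab, by simp [X, monomial_mul]⟩
    rw [hgen, mem_ideal_span_monomial_image]
    intro m hm
    by_contra! hcon
    -- If no generator divides `m`, no edge has both ends under the support of `m`. A minimal cover
    -- in the complement then gives an ideal that cannot contain `f`.
    have hcov : G.IsVertexCover (φ '' m.support)ᶜ := by
      intro x y hxy
      by_contra! h
      simp only [Set.mem_compl_iff, not_not] at h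
      obtain ⟨⟨a, ha, rfl⟩, ⟨b, hb, rfl⟩⟩ := h
      refine hcon _ ⟨a, b, hxy, rfl⟩ fun c => ?_
      have hab : a ≠ b := fun h => hxy.ne (congrArg φ h)
      simp only [Finset.mem_coe, Finsupp.mem_support_iff] at ha hb
      simp only [Finsupp.add_apply, Finsupp.single_apply]
      split_ifs with h1 h2 <;> grind
    obtain ⟨W, hWC, hW⟩ := SimpleGraph.exists_minimal_isVertexCover_subset hcov
    simp only [Ideal.mem_iInf] at hf
    obtain ⟨a, ha, hma⟩ := mem_ideal_span_X_image.1 (hf W hW) m hm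
    exact hWC ha ⟨a, by simpa using hma, rfl⟩
  · refine le_iInf₂ fun W hW => ?_
    rw [Ideal.span_le]
    rintro _ ⟨a, b, hab, rfl⟩
    rcases hW.prop hab with h | h
    · exact Ideal.mul_mem_right _ _ (Ideal.subset_span ⟨a, h, rfl⟩)
    · exact Ideal.mul_mem_left _ _ (Ideal.subset_span ⟨b, h, rfl⟩)

theorem edgeIdeal_eq_iInf [Finite V] (G : SimpleGraph V) :
    edgeIdeal k G = ⨅ W ∈ {W : Set V | Minimal G.IsVertexCover W}, Ideal.span (X '' W) :=
  (iInf_span_X_image_preimage G id).symm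

theorem jetCoverIdeal_eq (s : ℕ) (W : Set V) :
    jetCoverIdeal k s W = Ideal.span (X '' (Prod.fst ⁻¹' W)) := by
  refine congrArg Ideal.span (Set.ext fun f => ⟨?_, ?_⟩)
  · rintro ⟨x, hx, i, rfl⟩
    exact ⟨(x, i), hx, rfl⟩
  · rintro ⟨⟨x, i⟩, hx, rfl⟩
    exact ⟨x, hx, i, rfl⟩

theorem jetEdgeIdeal_eq_iInf [Finite V] (s : ℕ) (G : SimpleGraph V) :
    jetEdgeIdeal k s G
      = ⨅ W ∈ {W : Set V | Minimal G.IsVertexCover W}, jetCoverIdeal k s W := by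
  simp only [jetCoverIdeal_eq]
  rw [iInf_span_X_image_preimage]
  refine congrArg Ideal.span (Set.ext fun f => ⟨?_, ?_⟩)
  · rintro ⟨x, y, h, i, j, rfl⟩
    exact ⟨(x, i), (y, j), h, rfl⟩
  · rintro ⟨⟨x, i⟩, ⟨y, j⟩, h, rfl⟩
    exact ⟨x, y, h, i, j, rfl⟩

theorem edgeIdeal_le_of_isVertexCover {G : SimpleGraph V} {W : Set V} (hW : G.IsVertexCover W) :
    edgeIdeal k G ≤ Ideal.span (X '' W) := by
  refine Ideal.span_le.2 ?_
  rintro _ ⟨x, y, hxy, rfl⟩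
  rcases hW hxy with h | h
  · exact Ideal.mul_mem_right _ _ (Ideal.subset_span ⟨x, h, rfl⟩)
  · exact Ideal.mul_mem_left _ _ (Ideal.subset_span ⟨y, h, rfl⟩)

theorem minimalPrimes_edgeIdeal [Finite V] (G : SimpleGraph V) :
    (edgeIdeal k G).minimalPrimes
      = {q | ∃ W, Minimal G.IsVertexCover W ∧ q = Ideal.span (X '' W)} := by
  classical
  have key : ∀ q : Ideal (MvPolynomial V k), q.IsPrime → edgeIdeal k G ≤ q →
      ∃ W, Minimal G.IsVertexCover W ∧ Ideal.span (X '' W) ≤ q := by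
    intro q hq hle
    have hfin := Set.toFinite {W : Set V | Minimal G.IsVertexCover W}
    have h : hfin.toFinset.inf (fun W => Ideal.span (X '' W : Set (MvPolynomial V k))) ≤ q := by
      rw [Finset.inf_eq_iInf]
      simpa [edgeIdeal_eq_iInf] using hle
    obtain ⟨W, hW, hWq⟩ := (Ideal.IsPrime.inf_le' hq).1 h
    exact ⟨W, by simpa using hW, hWq⟩
  ext q
  constructor
  · intro hq
    obtain ⟨W, hW, hWq⟩ := key q hq.1.1 hq.1.2
    exact ⟨W, hW, (hq.2 ⟨isPrime_span_X_image W, edgeIdeal_le_of_isVertexCover hW.prop⟩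
      hWq).antisymm hWq⟩
  · rintro ⟨W, hW, rfl⟩
    refine ⟨⟨isPrime_span_X_image W, edgeIdeal_le_of_isVertexCover hW.prop⟩, ?_⟩
    rintro q ⟨hq, hle⟩ hqW
    obtain ⟨W', hW', hW'q⟩ := key q hq hle
    have hsub : W' ⊆ W := span_X_image_le_iff.1 (hW'q.trans hqW)
    rwa [hsub.antisymm (hW.le_of_le hW'.prop hsub)] at hW'q

/-! ### Smooth points and jets of the edge variety -/

section Points

variable {K : Type*} [Field K] [Algebra k K]

theorem mem_zeroLocus_edgeIdeal {G : SimpleGraph V} {p : V → K} :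
    p ∈ zeroLocus K (edgeIdeal k G) ↔ ∀ x y, G.Adj x y → p x = 0 ∨ p y = 0 := by
  rw [edgeIdeal, zeroLocus_span]
  constructor
  · intro h x y hxy
    simpa using h _ ⟨x, y, hxy, rfl⟩
  · rintro h _ ⟨x, y, hxy, rfl⟩
    simpa using h x y hxy

theorem mem_zeroLocus_span_X_image {σ : Type*} {W : Set σ} {p : σ → K} :
    p ∈ zeroLocus K (Ideal.span (X '' W : Set (MvPolynomial σ k))) ↔ ∀ x ∈ W, p x = 0 := by
  rw [zeroLocus_span]
  simp

/-- No Nullstellensatz is needed: over an infinite field, each coordinate subspace has enough points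
to recover its ideal. -/
theorem vanishingIdeal_zeroLocus_edgeIdeal [Infinite K] [Finite V] (G : SimpleGraph V) :
    vanishingIdeal k (zeroLocus K (edgeIdeal k G)) = edgeIdeal k G := by
  refine le_antisymm ?_ (le_vanishingIdeal_zeroLocus _)
  rw [edgeIdeal_eq_iInf]
  refine le_iInf₂ fun W hW f hf => ?_
  rw [← edgeIdeal_eq_iInf] at hf
  refine mem_span_X_image_of_aeval_eq_zero fun p hp _ => hf p ?_
  exact mem_zeroLocus_edgeIdeal.2 fun x y hxy => (hW.prop hxy).imp (hp x) (hp y)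

/-- The differential of an edge product `x y` is `p x * w y + p y * w x`, where at most one of `p
x`, `p y` is nonzero. -/
theorem mem_tangentSpace_zeroLocus_edgeIdeal [Infinite K] [Fintype V] {G : SimpleGraph V}
    {p : V → K} (hp : p ∈ zeroLocus K (edgeIdeal k G)) {w : V → K} :
    w ∈ tangentSpace k (zeroLocus K (edgeIdeal k G)) p
      ↔ ∀ y ∈ G.neighborsOf (Function.support p), w y = 0 := by
  classical
  have hmul : ∀ f g : MvPolynomial V k, ∑ v, aeval p (pderiv v (f * g)) * w v
      = aeval p f * (∑ v, aeval p (pderiv v g) * w v)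
        + aeval p g * (∑ v, aeval p (pderiv v f) * w v) := by
    intro f g
    rw [Finset.mul_sum, Finset.mul_sum, ← Finset.sum_add_distrib]
    refine Finset.sum_congr rfl fun v _ => ?_
    rw [Derivation.leibniz]
    simp only [smul_eq_mul, map_add, map_mul]
    ring
  have hX : ∀ x : V, ∑ v, aeval p (pderiv v (X x : MvPolynomial V k)) * w v = w x := by
    intro x
    rw [Finset.sum_eq_single x]
    · simp
    · intro v _ hv
      simp [pderiv_X_of_ne hv.symm]
    · simp
  change (∀ f ∈ vanishingIdeal k (zeroLocus K (edgeIdeal k G)), _) ↔ _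
  rw [vanishingIdeal_zeroLocus_edgeIdeal]
  constructor
  · rintro h y ⟨x, hx, hxy⟩
    have h1 := h (X x * X y) (Ideal.subset_span ⟨x, y, hxy, rfl⟩)
    have hy : p y = 0 := (mem_zeroLocus_edgeIdeal.1 hp x y hxy).resolve_left hx
    rw [hmul, hX, hX, aeval_X, aeval_X, hy, zero_mul, add_zero] at h1
    exact (mul_eq_zero.1 h1).resolve_left hx
  · intro h f hf
    induction hf using Submodule.span_induction with
    | mem f hf =>
      obtain ⟨x, y, hxy, rfl⟩ := hf
      rw [hmul, hX, hX, aeval_X, aeval_X]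
      have h1 : p x * w y = 0 := by
        by_cases hx : p x = 0
        · rw [hx, zero_mul]
        · rw [h y ⟨x, hx, hxy⟩, mul_zero]
      have h2 : p y * w x = 0 := by
        by_cases hy : p y = 0
        · rw [hy, zero_mul]
        · rw [h x ⟨y, hy, hxy.symm⟩, mul_zero]
      rw [h1, h2, add_zero]
    | zero => simp
    | add f g _ _ hf hg => simp only [map_add, add_mul, Finset.sum_add_distrib, hf, hg, add_zero]
    | smul a f hf ih => rw [smul_eq_mul, hmul, ih, hp f hf, mul_zero, zero_mul, add_zero]

theorem finrank_tangentSpace_zeroLocus_edgeIdeal [Infinite K] [Fintype V] {G : SimpleGraph V}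
    {p : V → K} (hp : p ∈ zeroLocus K (edgeIdeal k G)) :
    Module.finrank K (tangentSpace k (zeroLocus K (edgeIdeal k G)) p)
      = (G.neighborsOf (Function.support p))ᶜ.ncard := by
  classical
  set N := G.neighborsOf (Function.support p)
  have hker : tangentSpace k (zeroLocus K (edgeIdeal k G)) p
      = LinearMap.ker (LinearMap.funLeft K K (Subtype.val : N → V)) := by
    ext w
    rw [mem_tangentSpace_zeroLocus_edgeIdeal hp, LinearMap.mem_ker, funext_iff]
    simp [LinearMap.funLeft_apply, N]
  have hrank := (LinearMap.funLeft K K (Subtype.val : N → V)).finrank_range_add_finrank_ker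
  rw [LinearMap.range_eq_top.2
    (LinearMap.funLeft_surjective_of_injective K K _ Subtype.val_injective), finrank_top,
    Module.finrank_fintype_fun_eq_card, Module.finrank_fintype_fun_eq_card] at hrank
  rw [hker]
  have hcard := Set.ncard_add_ncard_compl N
  rw [← Nat.card_coe_set_eq, Nat.card_eq_fintype_card, Nat.card_eq_fintype_card] at hcard
  exact Nat.add_left_cancel (hrank.trans hcard.symm)

theorem mem_smoothLocus_zeroLocus_edgeIdeal [Infinite K] [Fintype V] {G : SimpleGraph V}
    {p : V → K} (hp : p ∈ zeroLocus K (edgeIdeal k G)) :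
    p ∈ smoothLocus k (zeroLocus K (edgeIdeal k G))
      ↔ G.IsVertexCover (G.neighborsOf (Function.support p)) := by
  classical
  set N := G.neighborsOf (Function.support p) with hN
  have hdim : localDim k (zeroLocus K (edgeIdeal k G)) p
      = ⨆ W ∈ {W | Minimal G.IsVertexCover W ∧ ∀ x ∈ W, p x = 0},
        (Wᶜ.ncard : WithBot ℕ∞) := by
    rw [localDim, vanishingIdeal_zeroLocus_edgeIdeal, minimalPrimes_edgeIdeal]
    apply le_antisymm
    · refine iSup₂_le ?_
      rintro _ ⟨⟨W, hW, rfl⟩, hpW⟩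
      rw [ringKrullDim_quotient_span_X_image]
      exact le_iSup₂_of_le W ⟨hW, mem_zeroLocus_span_X_image.1 hpW⟩ le_rfl
    · refine iSup₂_le ?_
      rintro W ⟨hW, hpW⟩
      rw [← ringKrullDim_quotient_span_X_image (k := k)]
      exact le_iSup₂_of_le (f := fun q _ => ringKrullDim (MvPolynomial V k ⧸ q)) _
        ⟨⟨W, hW, rfl⟩, mem_zeroLocus_span_X_image.2 hpW⟩ le_rfl
  have hsub : ∀ W, G.IsVertexCover W → (∀ x ∈ W, p x = 0) → N ⊆ W := fun W hW hpW =>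
    SimpleGraph.neighborsOf_subset hW (Set.disjoint_left.2 fun x hx hxs => hxs (hpW x hx))
  have hind : ∀ x ∈ Function.support p, ∀ y ∈ Function.support p, ¬ G.Adj x y :=
    fun x hx y hy hxy => (mem_zeroLocus_edgeIdeal.1 hp x y hxy).elim hx hy
  rw [smoothLocus, Set.mem_sep_iff, and_iff_right hp, finrank_tangentSpace_zeroLocus_edgeIdeal hp,
    hdim, ← hN]
  constructor
  · intro h
    by_contra hcov
    have hlt : ∀ W, Minimal G.IsVertexCover W ∧ (∀ x ∈ W, p x = 0) → Wᶜ.ncard < Nᶜ.ncard := by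
      rintro W ⟨hW, hpW⟩
      refine Set.ncard_lt_ncard (compl_lt_compl_iff_lt.2 ?_)
      refine (hsub W hW.prop hpW).ssubset_of_ne ?_
      rintro rfl
      exact hcov hW.prop
    -- Some component passes through `p`, so `Nᶜ.ncard` is positive and the truncated bound
    -- `Nᶜ.ncard - 1` on the supremum is a strict decrease.
    have hzero : G.IsVertexCover {x | p x = 0} :=
      fun x y hxy => mem_zeroLocus_edgeIdeal.1 hp x y hxy
    obtain ⟨W₀, hW₀, hmin⟩ := SimpleGraph.exists_minimal_isVertexCover_subset hzero
    have hpos := hlt W₀ ⟨hmin, fun x hx => hW₀ hx⟩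
    have hle : (Nᶜ.ncard : WithBot ℕ∞) ≤ ((Nᶜ.ncard - 1 : ℕ) : WithBot ℕ∞) := by
      rw [h]
      refine iSup₂_le fun W hW => ?_
      have := hlt W hW
      exact_mod_cast (by omega : Wᶜ.ncard ≤ Nᶜ.ncard - 1)
    have : Nᶜ.ncard ≤ Nᶜ.ncard - 1 := by exact_mod_cast hle
    omega
  · intro hcov
    have hpN : ∀ x ∈ N, p x = 0 := by
      rintro y ⟨x, hx, hxy⟩
      exact (mem_zeroLocus_edgeIdeal.1 hp x y hxy).resolve_left hx
    apply le_antisymm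
    · exact le_iSup₂_of_le (f := fun (W : Set V) _ => (Wᶜ.ncard : WithBot ℕ∞)) N
        ⟨SimpleGraph.minimal_neighborsOf hind hcov, hpN⟩ le_rfl
    · refine iSup₂_le fun W hW => ?_
      exact_mod_cast Set.ncard_le_ncard (Set.compl_subset_compl.2 (hsub W hW.1.prop hW.2))

/-- The truncated arc `∑ γ(x, i) tⁱ` of the vertex `x` along a jet `γ`. -/
noncomputable def jetArc {s : ℕ} (γ : V × Fin (s + 1) → K) (x : V) : Polynomial K :=
  ∑ i : Fin (s + 1), Polynomial.C (γ (x, i)) * Polynomial.X ^ (i : ℕ)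

theorem coeff_jetArc {s : ℕ} (γ : V × Fin (s + 1) → K) (x : V) (i : Fin (s + 1)) :
    (jetArc γ x).coeff i = γ (x, i) := by
  simp only [jetArc, Polynomial.finsetSum_coeff, Polynomial.coeff_C_mul, Polynomial.coeff_X_pow]
  rw [Finset.sum_eq_single i]
  · simp
  · intro j _ hj
    rw [if_neg (fun h => hj (Fin.ext h.symm)), mul_zero]
  · simp

/-- Turns the jet equations into the vanishing of `f` along the arcs modulo `t^(s+1)`. -/
theorem aeval_coeff_jetHom {s : ℕ} (γ : V × Fin (s + 1) → K) (f : MvPolynomial V k) (l : ℕ) :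
    aeval γ ((jetHom k V s f).coeff l) = (aeval (jetArc γ) f).coeff l := by
  have h : (Polynomial.mapAlgHom (aeval γ : JetRing k V s →ₐ[k] K)).comp (jetHom k V s)
      = aeval (jetArc γ) := by
    ext1 x
    simp [jetHom, jetArc, Polynomial.map_sum]
  rw [← h]
  simp

/-- A jet of the edge variety is constantly zero on the neighbours of the support of its base
point. -/
theorem apply_eq_zero_of_mem_jetVariety {s : ℕ} {G : SimpleGraph V} {γ : V × Fin (s + 1) → K}
    (hγ : γ ∈ jetVariety k s (zeroLocus K (edgeIdeal k G))) {y : V}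
    (hy : y ∈ G.neighborsOf (Function.support (jetBase s γ))) (i : Fin (s + 1)) :
    γ (y, i) = 0 := by
  obtain ⟨x, hx, hxy⟩ := hy
  have hdvd : Polynomial.X ^ (s + 1) ∣ jetArc γ x * jetArc γ y := by
    rw [Polynomial.X_pow_dvd_iff]
    intro l hl
    have hmem : (X x * X y : MvPolynomial V k)
        ∈ vanishingIdeal k (zeroLocus K (edgeIdeal k G)) :=
      le_vanishingIdeal_zeroLocus _ (Ideal.subset_span ⟨x, y, hxy, rfl⟩)
    have h := hγ _ (Ideal.subset_span ⟨_, hmem, l, Nat.lt_succ_iff.1 hl, rfl⟩)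
    rw [aeval_coeff_jetHom] at h
    simpa using h
  have hndvd : ¬ Polynomial.X ∣ jetArc γ x := by
    rw [Polynomial.X_dvd_iff]
    have h0 := coeff_jetArc γ x 0
    rw [Fin.val_zero] at h0
    rw [h0]
    exact hx
  have h := Polynomial.prime_X.pow_dvd_of_dvd_mul_left (s + 1) hndvd hdvd
  rw [← coeff_jetArc γ y i]
  exact Polynomial.X_pow_dvd_iff.1 h i i.isLt

theorem mem_jetVariety_of_isVertexCover [Infinite K] [Finite V] {s : ℕ} {G : SimpleGraph V}
    {W : Set V} (hW : G.IsVertexCover W) {γ : V × Fin (s + 1) → K}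
    (hγ : ∀ x ∈ W, ∀ i, γ (x, i) = 0) :
    γ ∈ jetVariety k s (zeroLocus K (edgeIdeal k G)) := by
  rw [jetVariety, jetIdeal, zeroLocus_span, vanishingIdeal_zeroLocus_edgeIdeal]
  rintro _ ⟨f, hf, l, -, rfl⟩
  have hle : Ideal.span (X '' W)
      ≤ RingHom.ker (aeval (jetArc γ) : MvPolynomial V k →ₐ[k] Polynomial K) := by
    rw [Ideal.span_le]
    rintro _ ⟨x, hx, rfl⟩
    change aeval (jetArc γ) (X x) = 0
    simp [jetArc, hγ x hx]
  have h0 : aeval (jetArc γ) f = 0 := hle (edgeIdeal_le_of_isVertexCover hW hf)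
  rw [aeval_coeff_jetHom, h0, Polynomial.coeff_zero]

theorem vanishingIdeal_principalComponent [Infinite K] [Fintype V] (G : SimpleGraph V) (s : ℕ) :
    vanishingIdeal k (principalComponent k K s G)
      = ⨅ W ∈ {W : Set V | Minimal G.IsVertexCover W}, jetCoverIdeal k s W := by
  rw [principalComponent, zariskiClosure, vanishingIdeal_zeroLocus_vanishingIdeal]
  apply le_antisymm
  · refine le_iInf₂ fun W hW f hf => ?_
    rw [jetCoverIdeal_eq]
    -- It suffices to test jets that are zero exactly over `W`. Their base point has support `Wᶜ`,
    -- whose neighbours form `W`, so it is smooth.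
    refine mem_span_X_image_of_aeval_eq_zero fun γ hγ hγ' => hf γ ?_
    have hsupp : Function.support (jetBase s γ) = Wᶜ := by
      ext x
      exact ⟨fun hx hxW => hx (hγ (x, 0) hxW), fun hx => hγ' (x, 0) hx⟩
    refine ⟨mem_jetVariety_of_isVertexCover hW.prop fun x hx i => hγ (x, i) hx, ?_⟩
    rw [mem_smoothLocus_zeroLocus_edgeIdeal, hsupp, SimpleGraph.neighborsOf_compl_of_minimal hW]
    · exact hW.prop
    · exact mem_zeroLocus_edgeIdeal.2 fun x y hxy =>
        (hW.prop hxy).imp (fun h => hγ (x, 0) h) (fun h => hγ (y, 0) h)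
  · rintro f hf γ ⟨hγ, hsm⟩
    have hp := hsm.1
    have hcov := (mem_smoothLocus_zeroLocus_edgeIdeal hp).1 hsm
    have hmin := SimpleGraph.minimal_neighborsOf
      (fun x hx y hy hxy => (mem_zeroLocus_edgeIdeal.1 hp x y hxy).elim hx hy) hcov
    simp only [Ideal.mem_iInf] at hf
    have hfW := hf _ hmin
    rw [jetCoverIdeal_eq] at hfW
    refine mem_zeroLocus_span_X_image.2 ?_ f hfW
    rintro ⟨y, i⟩ hy
    exact apply_eq_zero_of_mem_jetVariety hγ hy i

end Points

end JetGraph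

theorem mainTheorem4 {k K V : Type*} [Field k] [Field K] [Algebra k K] [Infinite K] [Fintype V]
    (G : SimpleGraph V) (s : ℕ) :
    (MvPolynomial.vanishingIdeal k (JetGraph.principalComponent k K s G)
        = JetGraph.jetEdgeIdeal k s G) ∧
    (MvPolynomial.vanishingIdeal k (JetGraph.principalComponent k K s G)
        = ⨅ W ∈ {W : Set V | Minimal G.IsVertexCover W}, JetGraph.jetCoverIdeal k s W) ∧
    (∀ W : Set V, Minimal G.IsVertexCover W → (JetGraph.jetCoverIdeal k s W).IsPrime) := by
  refine ⟨?_, JetGraph.vanishingIdeal_principalComponent G s, fun W _ => ?_⟩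
  · rw [JetGraph.vanishingIdeal_principalComponent, JetGraph.jetEdgeIdeal_eq_iInf]
  · rw [JetGraph.jetCoverIdeal_eq]
    exact isPrime_span_X_image _
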